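/- Let $A=C^{\infty}(\mathbb R^3)$ be the algebra of real-valued smooth functions. For an $\mathbb R$-linear map $\gamma:A\to A$ and an $\mathbb R$-bilinear map $F:A\times A\to A$ write $$(\delta\gamma)(a,b)=a\gamma(b)-\gamma(ab)+\gamma(a)b,$$ $$(\delta F)(a,b,c)=aF(b,c)-F(ab,c)+F(a,bc)-F(a,b)c,$$ $$(F\circ F)(a,b,c)=F(F(a,b),c)-F(a,F(b,c)).$$ A differential 1-cochain is a finite sum of maps $a\,\partial_{i_1}\cdots\partial_{i_r}$ with $a\in A$, $r\ge 0$; a differential 2-cochain is a finite sum of maps $(a,b)\mapsto f(a)g(b)$ with $f,g$ differential 1-cochains. An infinitesimal deformation of $A$ is an $\mathbb R$-bilinear $F_1:A\times A\to A$ with $\delta F_1=0$ that represents a class of the differential Hochschild cohomology of $A$, i.e. such that $F_1-\delta\gamma$ is a differential 2-cochain for some $\mathbb R$-linear $\gamma:A\to A$. Its primary obstruction vanishes if $F_1\circ F_1=\delta G$ for some $\mathbb R$-bilinear $G:A\times A\to A$. Let $\varphi\in A$. (i) If $F_1$ is an infinitesimal deformation of $A$ whose primary obstruction vanishes, then $\varphi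 F_1$ is an infinitesimal deformation of $A$ whose primary obstruction vanishes. (ii) The same holds within the differential subcomplex: if $F_1$ is a differential 2-cocycle and $F_1\circ F_1=\delta G$ for some differential 2-cochain $G$, then $\varphi F_1$ is a differential 2-cocycle and $(\varphi F_1)\circ(\varphi F_1)=\delta G'$ for some differential 2-cochain $G'$. (iii) In particular, if a skew biderivation $F_1$ of $A$ is Poisson, i.e. satisfies the Jacobi identity $F_1(a,F_1(b,c))+F_1(b,F_1(c,a))+F_1(c,F_1(a,b))=0$ for all $a,b,c\in A$, then $\varphi F_1$ is again a Poisson skew biderivation. -/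

import Mathlib

open scoped ContDiff Manifold

noncomputable section

/-! ## Low-degree Hochschild cochains of a commutative algebra, with coefficients in itself -/

section Hochschild

variable {k A : Type*} [CommRing k] [CommRing A] [Algebra k A]

/-- The cup product `f ⌣ g` of two 1-cochains: `(f ⌣ g)(a, b) = f a * g b`. -/
def cupProd (f g : A →ₗ[k] A) : A →ₗ[k] A →ₗ[k] A :=
  (LinearMap.mul k A).compl₁₂ f g

/-- The multiple `φ F` of a 2-cochain by an element of the algebra:
`(φ F)(a, b) = φ * F(a, b)`. -/
def scaleCochain (φ : A) (F : A →ₗ[k] A →ₗ[k] A) : A →ₗ[k] A →ₗ[k] A :=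
  F.compr₂ (LinearMap.mulLeft k φ)

/-- The Hochschild coboundary of a 1-cochain: `(δγ)(a, b) = a γ(b) - γ(ab) + γ(a) b`. -/
def coboundaryOne (γ : A →ₗ[k] A) : A →ₗ[k] A →ₗ[k] A :=
  cupProd LinearMap.id γ - (LinearMap.mul k A).compr₂ γ + cupProd γ LinearMap.id

/-- The Hochschild coboundary of a 2-cochain:
`(δF)(a, b, c) = a F(b, c) - F(ab, c) + F(a, bc) - F(a, b) c`. -/
def coboundaryTwo (F : A →ₗ[k] A →ₗ[k] A) (a b c : A) : A :=
  a * F b c - F (a * b) c + F a (b * c) - F a b * c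

/-- The composition product of 2-cochains:
`(F ∘ G)(a, b, c) = F(G(a, b), c) - F(a, G(b, c))`. -/
def compProd (F G : A →ₗ[k] A →ₗ[k] A) (a b c : A) : A :=
  F (G a b) c - F a (G b c)

/-- Hochschild 2-cocycles. -/
def IsTwoCocycle (F : A →ₗ[k] A →ₗ[k] A) : Prop :=
  ∀ a b c, coboundaryTwo F a b c = 0

/-- The primary obstruction of `F`, that is, the class of `F ∘ F` in `H³(A, A)`, vanishes:
`F ∘ F` is the coboundary of a 2-cochain. -/
def PrimaryObstructionVanishes (F : A →ₗ[k] A →ₗ[k] A) : Prop :=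
  ∃ G : A →ₗ[k] A →ₗ[k] A, ∀ a b c, compProd F F a b c = coboundaryTwo G a b c

/-- Skew 2-cochains. -/
def IsSkew (F : A →ₗ[k] A →ₗ[k] A) : Prop :=
  ∀ a b, F a b = -F b a

/-- Biderivations. -/
def IsBiderivation (F : A →ₗ[k] A →ₗ[k] A) : Prop :=
  (∀ a b c, F (a * b) c = a * F b c + b * F a c) ∧
    ∀ a b c, F a (b * c) = b * F a c + c * F a b

/-- Poisson structures: skew biderivations that satisfy the Jacobi identity. -/
def IsPoisson (F : A →ₗ[k] A →ₗ[k] A) : Prop :=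
  IsSkew F ∧ IsBiderivation F ∧
    ∀ a b c, F a (F b c) + F b (F c a) + F c (F a b) = 0

end Hochschild

/-! ## The algebra of smooth functions and its differential cochains -/

/-- The real algebra `C^∞(ℝ^d)` of smooth real-valued functions on `ℝ^d`. -/
abbrev SmoothFun (d : ℕ) : Type :=
  C^∞⟮𝓘(ℝ, EuclideanSpace ℝ (Fin d)), EuclideanSpace ℝ (Fin d); 𝓘(ℝ, ℝ), ℝ⟯

/-- The partial derivative `∂ᵢ` as an `ℝ`-linear endomorphism of `C^∞(ℝ^d)`. -/
def partialDeriv {d : ℕ} (i : Fin d) : SmoothFun d →ₗ[ℝ] SmoothFun d where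
  toFun f :=
    ⟨fun x => fderiv ℝ f x (EuclideanSpace.single i 1),
      ((f.contMDiff.contDiff.fderiv_right (m := ∞) le_rfl).clm_apply contDiff_const).contMDiff⟩
  map_add' f g := by
    ext x
    have hf : DifferentiableAt ℝ f x := (f.contMDiff.contDiff.differentiable (by simp)) x
    have hg : DifferentiableAt ℝ g x := (g.contMDiff.contDiff.differentiable (by simp)) x
    change fderiv ℝ (⇑f + ⇑g) x _ = fderiv ℝ f x _ + fderiv ℝ g x _
    rw [fderiv_add hf hg]
    rfl
  map_smul' r f := by
    ext x
    have hf : DifferentiableAt ℝ f x := (f.contMDiff.contDiff.differentiable (by simp)) x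
    change fderiv ℝ (r • ⇑f) x _ = r • fderiv ℝ f x _
    rw [fderiv_const_smul hf]
    rfl

/-- The iterated partial derivative `∂_{i₁} ∂_{i₂} ⋯ ∂_{iᵣ}` for `I = [i₁, …, iᵣ]`
(the identity for `I = []`). -/
def iterPartial {d : ℕ} (I : List (Fin d)) : SmoothFun d →ₗ[ℝ] SmoothFun d :=
  I.foldr (fun i D => partialDeriv i ∘ₗ D) LinearMap.id

/-- Differential 1-cochains: finite sums of cochains `a ∂_{i₁} ⋯ ∂_{iᵣ}`, with `a` smooth. -/
def diffOneCochains (d : ℕ) : Submodule ℝ (SmoothFun d →ₗ[ℝ] SmoothFun d) :=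
  Submodule.span ℝ
    {γ | ∃ (a : SmoothFun d) (I : List (Fin d)), γ = LinearMap.mulLeft ℝ a ∘ₗ iterPartial I}

/-- Differential 2-cochains: finite sums of cup products of differential 1-cochains. -/
def diffTwoCochains (d : ℕ) : Submodule ℝ (SmoothFun d →ₗ[ℝ] SmoothFun d →ₗ[ℝ] SmoothFun d) :=
  Submodule.span ℝ
    {F | ∃ f ∈ diffOneCochains d, ∃ g ∈ diffOneCochains d, F = cupProd f g}

/-- An infinitesimal deformation of `C^∞(ℝ^d)`: a Hochschild 2-cocycle (an arbitrary bilinear one)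
that represents a class of the differential Hochschild cohomology, that is, which is cohomologous
to a differential cocycle. Every differential cocycle is one (take `γ = 0`). -/
def IsInfinitesimalDeformation {d : ℕ} (F : SmoothFun d →ₗ[ℝ] SmoothFun d →ₗ[ℝ] SmoothFun d) :
    Prop :=
  IsTwoCocycle F ∧
    ∃ γ : SmoothFun d →ₗ[ℝ] SmoothFun d, F - coboundaryOne γ ∈ diffTwoCochains d

/-- The primary obstruction of `F` vanishes within the differential subcomplex: `F ∘ F` is the
coboundary of a differential 2-cochain. -/
def DiffPrimaryObstructionVanishes {d : ℕ}
    (F : SmoothFun d →ₗ[ℝ] SmoothFun d →ₗ[ℝ] SmoothFun d) : Prop :=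
  ∃ G ∈ diffTwoCochains d, ∀ a b c, compProd F F a b c = coboundaryTwo G a b c

end

noncomputable section

/-! ## Commutative algebra of 2-cochains -/

section Hochschild

variable {k A : Type*} [CommRing k] [CommRing A] [Algebra k A]

/-! Only the skew part of a cocycle carries its class, and in dimension three the obstruction of a
bivector is insensitive to smooth factors. A differential 2-cocycle equals its skew part `P`, a
biderivation, plus `δγ` (`IsTwoCocycle.exists_eq_skewPart_add`). Vanishing of the obstruction passes
between cohomologous cocycles, by gauge transformation (`compProd_add_coboundaryOne`). For `P` it is
equivalent to Jacobi: antisymmetrising `P ∘ P = δG` kills `δG` and leaves the Jacobiator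
(`IsBiderivation.isPoisson`), and conversely the second-order term of Kontsevich's star product is
an explicit differential `G` (`compProd_eq_coboundaryTwo_secondStarTerm`). The Jacobiator of `φP` is
`φ²` times that of `P` plus `φ` times a contraction of `P ∧ P`, a 4-vector, which is zero on
three-space (`IsPoisson.scaleCochain`). Since `φ δγ = δ(φγ)`, the conclusion returns from `φP` to
`φF`. The decomposition of `F` rests on symmetric differential cocycles being coboundaries.
Evaluating on exponentials turns a cochain into a polynomial symbol, and a symmetric homogeneous
symbol cocycle is recovered from its diagonal by a doubling identity. -/

@[simp]
lemma cupProd_apply (f g : A →ₗ[k] A) (a b : A) : cupProd f g a b = f a * g b := rfl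

@[simp]
lemma scaleCochain_apply (φ : A) (F : A →ₗ[k] A →ₗ[k] A) (a b : A) :
    scaleCochain φ F a b = φ * F a b := rfl

lemma coboundaryOne_apply (γ : A →ₗ[k] A) (a b : A) :
    coboundaryOne γ a b = a * γ b - γ (a * b) + γ a * b := rfl

lemma isTwoCocycle_coboundaryOne (γ : A →ₗ[k] A) : IsTwoCocycle (coboundaryOne γ) := by
  intro a b c
  simp only [coboundaryTwo, coboundaryOne_apply, mul_assoc]
  ring

lemma IsTwoCocycle.sub {F G : A →ₗ[k] A →ₗ[k] A} (hF : IsTwoCocycle F) (hG : IsTwoCocycle G) :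
    IsTwoCocycle (F - G) := by
  intro a b c
  have h₁ := hF a b c
  have h₂ := hG a b c
  simp only [coboundaryTwo, LinearMap.sub_apply] at *
  linear_combination h₁ - h₂

lemma IsTwoCocycle.scaleCochain {F : A →ₗ[k] A →ₗ[k] A} (hF : IsTwoCocycle F) (φ : A) :
    IsTwoCocycle (scaleCochain φ F) := by
  intro a b c
  have h₁ := hF a b c
  simp only [coboundaryTwo, scaleCochain_apply] at *
  linear_combination φ * h₁

/-- `δ` is linear over the commutative algebra `A`, so multiplication by `φ` acts on cohomology
classes. -/
lemma scaleCochain_coboundaryOne (φ : A) (γ : A →ₗ[k] A) :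
    scaleCochain φ (coboundaryOne γ) = coboundaryOne (LinearMap.mulLeft k φ ∘ₗ γ) := by
  ext a b
  simp only [coboundaryOne_apply, scaleCochain_apply, LinearMap.comp_apply,
    LinearMap.mulLeft_apply]
  ring

lemma scaleCochain_add (φ : A) (F G : A →ₗ[k] A →ₗ[k] A) :
    scaleCochain φ (F + G) = scaleCochain φ F + scaleCochain φ G := by
  ext a b
  simp [mul_add]

/-- The second-order term of the gauge transformation `id + t γ` applied to `F`. -/
def gaugeCorrection (F : A →ₗ[k] A →ₗ[k] A) (γ : A →ₗ[k] A) : A →ₗ[k] A →ₗ[k] A :=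
  cupProd γ γ + F.compl₁₂ γ LinearMap.id + F.compl₁₂ LinearMap.id γ
    - (cupProd γ LinearMap.id + cupProd LinearMap.id γ + F).compr₂ γ
    + (LinearMap.mul k A).compr₂ (γ ∘ₗ γ)

lemma gaugeCorrection_apply (F : A →ₗ[k] A →ₗ[k] A) (γ : A →ₗ[k] A) (a b : A) :
    gaugeCorrection F γ a b =
      γ a * γ b + F (γ a) b + F a (γ b) - γ (γ a * b + a * γ b + F a b) + γ (γ (a * b)) := rfl

/-- Conjugating the product `ab + tF(a, b)` by `id + tγ` gives first-order term `F + δγ` and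
second-order term `gaugeCorrection F γ`. As the associativity defect has no term of order `t`, its
`t²` term is unchanged by the conjugation. -/
lemma compProd_add_coboundaryOne {F : A →ₗ[k] A →ₗ[k] A} (hF : IsTwoCocycle F) (γ : A →ₗ[k] A)
    (a b c : A) :
    compProd (F + coboundaryOne γ) (F + coboundaryOne γ) a b c =
      compProd F F a b c + coboundaryTwo (gaugeCorrection F γ) a b c := by
  have h₁ := hF (γ a) b c
  have h₂ := hF a (γ b) c
  have h₃ := hF a b (γ c)
  have h₄ := congrArg γ (hF a b c)
  simp only [coboundaryTwo, compProd, gaugeCorrection_apply, coboundaryOne_apply,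
    LinearMap.add_apply, LinearMap.sub_apply, map_add, map_sub, map_zero, add_mul, mul_add,
    sub_mul, mul_sub,
    mul_assoc] at *
  linear_combination (-1 : A) * h₁ - h₂ - h₃ + h₄

lemma coboundaryTwo_add (F G : A →ₗ[k] A →ₗ[k] A) (a b c : A) :
    coboundaryTwo (F + G) a b c = coboundaryTwo F a b c + coboundaryTwo G a b c := by
  simp only [coboundaryTwo, LinearMap.add_apply]
  ring

lemma compProd_of_eq_add_coboundaryOne {F P : A →ₗ[k] A →ₗ[k] A} {γ : A →ₗ[k] A}
    (hP : IsTwoCocycle P) (h : ∀ a b, F a b = P a b + coboundaryOne γ a b) (a b c : A) :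
    compProd F F a b c = compProd P P a b c + coboundaryTwo (gaugeCorrection P γ) a b c := by
  obtain rfl : F = P + coboundaryOne γ := LinearMap.ext₂ h
  exact compProd_add_coboundaryOne hP γ a b c

/-- Vanishing of the primary obstruction only depends on the cohomology class. -/
lemma PrimaryObstructionVanishes.of_eq_add_coboundaryOne {F P : A →ₗ[k] A →ₗ[k] A}
    {γ : A →ₗ[k] A} (hv : PrimaryObstructionVanishes P) (hP : IsTwoCocycle P)
    (h : ∀ a b, F a b = P a b + coboundaryOne γ a b) : PrimaryObstructionVanishes F := by
  obtain ⟨G, hG⟩ := hv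
  refine ⟨G + gaugeCorrection P γ, fun a b c => ?_⟩
  rw [compProd_of_eq_add_coboundaryOne hP h, hG, coboundaryTwo_add]

lemma coboundaryOne_neg_apply (γ : A →ₗ[k] A) (a b : A) :
    coboundaryOne (-γ) a b = -coboundaryOne γ a b := by
  simp only [coboundaryOne_apply, LinearMap.neg_apply]
  ring

lemma scaleCochain_eq_add_coboundaryOne {F P : A →ₗ[k] A →ₗ[k] A} {γ : A →ₗ[k] A}
    (h : ∀ a b, F a b = P a b + coboundaryOne γ a b) (φ a b : A) :
    scaleCochain φ F a b =
      scaleCochain φ P a b + coboundaryOne (LinearMap.mulLeft k φ ∘ₗ γ) a b := by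
  rw [← scaleCochain_coboundaryOne]
  simp only [scaleCochain_apply, h, mul_add]

lemma IsBiderivation.isTwoCocycle {P : A →ₗ[k] A →ₗ[k] A} (hP : IsBiderivation P) :
    IsTwoCocycle P := by
  intro a b c
  simp only [coboundaryTwo, hP.1, hP.2]
  ring

lemma IsSkew.scaleCochain {P : A →ₗ[k] A →ₗ[k] A} (hP : IsSkew P) (φ : A) :
    IsSkew (scaleCochain φ P) := by
  intro a b
  rw [scaleCochain_apply, scaleCochain_apply, hP a b, mul_neg]

lemma IsBiderivation.scaleCochain {P : A →ₗ[k] A →ₗ[k] A} (hP : IsBiderivation P) (φ : A) :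
    IsBiderivation (scaleCochain φ P) := by
  refine ⟨fun a b c => ?_, fun a b c => ?_⟩
  · simp only [scaleCochain_apply, hP.1]
    ring
  · simp only [scaleCochain_apply, hP.2]
    ring

end Hochschild

/-! ### Skew parts of cocycles, and Jacobi from a vanishing obstruction -/

section SkewPart

variable {A : Type*} [CommRing A] [Algebra ℝ A]

/-- The skew part of a 2-cochain. -/
def skewPart (F : A →ₗ[ℝ] A →ₗ[ℝ] A) : A →ₗ[ℝ] A →ₗ[ℝ] A :=
  (1 / 2 : ℝ) • (F - F.flip)

lemma skewPart_apply (F : A →ₗ[ℝ] A →ₗ[ℝ] A) (a b : A) :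
    skewPart F a b = (1 / 2 : ℝ) • (F a b - F b a) := rfl

lemma two_mul_skewPart_apply (F : A →ₗ[ℝ] A →ₗ[ℝ] A) (a b : A) :
    2 * skewPart F a b = F a b - F b a := by
  rw [skewPart_apply, two_mul, ← add_smul]
  norm_num

lemma eq_of_two_mul_eq {a b : A} (h : 2 * a = 2 * b) : a = b := by
  have h' : (2 : ℝ) • a = (2 : ℝ) • b := by
    rw [two_smul, two_smul, ← two_mul, ← two_mul, h]
  exact smul_right_injective A (two_ne_zero (α := ℝ)) h'

lemma isSkew_skewPart (F : A →ₗ[ℝ] A →ₗ[ℝ] A) : IsSkew (skewPart F) := by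
  intro a b
  rw [skewPart_apply, skewPart_apply, ← smul_neg, neg_sub]

/-- The signed sum of the cocycle identity over the shuffles of `c` into `(a, b)` is the Leibniz
rule, by commutativity. No differentiability of `F` is involved. -/
lemma IsTwoCocycle.isBiderivation_skewPart {F : A →ₗ[ℝ] A →ₗ[ℝ] A} (hF : IsTwoCocycle F) :
    IsBiderivation (skewPart F) := by
  have key : ∀ a b c, skewPart F (a * b) c = a * skewPart F b c + b * skewPart F a c := by
    intro a b c
    apply eq_of_two_mul_eq
    have h₁ := hF a b c
    have h₂ := hF a c b
    have h₃ := hF c a b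
    have e₁ := two_mul_skewPart_apply F (a * b) c
    have e₂ := two_mul_skewPart_apply F a c
    have e₃ := two_mul_skewPart_apply F b c
    simp only [coboundaryTwo] at h₁ h₂ h₃
    rw [mul_comm c b] at h₂
    rw [mul_comm c a] at h₃
    linear_combination e₁ - a * e₃ - b * e₂ - h₁ + h₂ - h₃
  refine ⟨key, fun a b c => ?_⟩
  rw [isSkew_skewPart F a, isSkew_skewPart F a, isSkew_skewPart F a, key]
  ring

/-- A skew biderivation whose primary obstruction vanishes is a Poisson structure. -/
lemma IsBiderivation.isPoisson {P : A →ₗ[ℝ] A →ₗ[ℝ] A} (hP : IsBiderivation P)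
    (hs : IsSkew P) (h : PrimaryObstructionVanishes P) : IsPoisson P := by
  refine ⟨hs, hP, fun a b c => ?_⟩
  obtain ⟨G, hG⟩ := h
  -- The alternating sum of `P ∘ P` over the six permutations is `-4` times the Jacobiator, hence
  -- two divisions by 2. The same sum of `δG` cancels for every bilinear `G`, because `A` is
  -- commutative.
  apply eq_of_two_mul_eq
  apply eq_of_two_mul_eq
  have h₁ := hG a b c
  have h₂ := hG b c a
  have h₃ := hG c a b
  have h₄ := hG b a c
  have h₅ := hG a c b
  have h₆ := hG c b a
  simp only [compProd, coboundaryTwo] at h₁ h₂ h₃ h₄ h₅ h₆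
  rw [hs (P _ _) _] at h₁ h₂ h₃ h₄ h₅ h₆
  rw [hs b a, map_neg] at h₄
  rw [hs c b, map_neg] at h₆
  rw [hs a c, map_neg] at h₅
  rw [hs a c, map_neg] at h₄
  rw [hs b a, map_neg] at h₆
  rw [hs c b, map_neg] at h₅
  rw [mul_comm b a, mul_comm c b, mul_comm a c] at *
  linear_combination (-1 : A) * h₁ - h₂ - h₃ + h₄ + h₅ + h₆

end SkewPart

end

noncomputable section

/-! ### The obstruction of a Poisson bivector, in terms of commuting derivations -/

section ConstantDerivations

variable {A ι : Type*} [CommRing A] [Algebra ℝ A]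

/-- The first-order coefficients `Q j k l = ∑ i, p i j * ∂ i (p k l)`. -/
def contractDeriv [Fintype ι] (D : ι → A →ₗ[ℝ] A) (p : ι → ι → A) (j k l : ι) : A :=
  ∑ i, p i j * D i (p k l)

/-- The second-order term of Kontsevich's star product, for the bivector `∑ p i j ∂ᵢ ⊗ ∂ⱼ`. -/
def secondStarTerm [Fintype ι] (D : ι → A →ₗ[ℝ] A) (p : ι → ι → A) : A →ₗ[ℝ] A →ₗ[ℝ] A :=
  (∑ e : ι × ι, ∑ e' : ι × ι,
      scaleCochain (algebraMap ℝ A (1 / 2) * (p e.1 e.2 * p e'.1 e'.2))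
        (cupProd (D e.1 ∘ₗ D e'.1) (D e.2 ∘ₗ D e'.2))) +
    ∑ j, ∑ k, ∑ l, scaleCochain (algebraMap ℝ A (1 / 3) * contractDeriv D p j k l)
      (cupProd (D k) (D j ∘ₗ D l) - cupProd (D j ∘ₗ D k) (D l))

lemma coboundaryTwo_sum {κ : Type*} (s : Finset κ) (F : κ → A →ₗ[ℝ] A →ₗ[ℝ] A) (a b c : A) :
    coboundaryTwo (∑ i ∈ s, F i) a b c = ∑ i ∈ s, coboundaryTwo (F i) a b c := by
  simp only [coboundaryTwo, LinearMap.sum_apply, Finset.sum_add_distrib, Finset.sum_sub_distrib,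
    Finset.mul_sum, Finset.sum_mul]

lemma coboundaryTwo_scaleCochain (φ : A) (F : A →ₗ[ℝ] A →ₗ[ℝ] A) (a b c : A) :
    coboundaryTwo (scaleCochain φ F) a b c = φ * coboundaryTwo F a b c := by
  simp only [coboundaryTwo, scaleCochain_apply]
  ring

lemma coboundaryTwo_cupProd_comp_comp {D : ι → A →ₗ[ℝ] A}
    (hD : ∀ i a b, D i (a * b) = a * D i b + b * D i a) (i j k l : ι) (a b c : A) :
    coboundaryTwo (cupProd (D i ∘ₗ D k) (D j ∘ₗ D l)) a b c =
      D i (D k a) * (D j b * D l c + D l b * D j c)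
        - (D i a * D k b + D k a * D i b) * D j (D l c) := by
  simp only [coboundaryTwo, cupProd_apply, LinearMap.comp_apply, hD, map_add]
  ring

lemma coboundaryTwo_cupProd_sub {D : ι → A →ₗ[ℝ] A}
    (hD : ∀ i a b, D i (a * b) = a * D i b + b * D i a) (j k l : ι) (a b c : A) :
    coboundaryTwo (cupProd (D k) (D j ∘ₗ D l) - cupProd (D j ∘ₗ D k) (D l)) a b c =
      D k a * (D j b * D l c + D l b * D j c) + (D j a * D k b + D k a * D j b) * D l c := by
  simp only [coboundaryTwo, cupProd_apply, LinearMap.comp_apply, hD, map_add,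
    LinearMap.sub_apply]
  ring

/-- Expanding `P ∘ P` by the Leibniz rule gives second-order parts `U + V` and `V + W`, so `V`
cancels. The first sum in `secondStarTerm` has coboundary `U - W`; the second accounts for the terms
containing derivatives of `p`, through Jacobi. -/
lemma compProd_eq_coboundaryTwo_secondStarTerm [Fintype ι] {D : ι → A →ₗ[ℝ] A}
    (hD : ∀ i a b, D i (a * b) = a * D i b + b * D i a)
    (hcomm : ∀ i j a, D i (D j a) = D j (D i a))
    {p : ι → ι → A} (hskew : ∀ i j, p i j = -p j i)
    (hjac : ∀ i j k, contractDeriv D p i j k + contractDeriv D p j k i +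
      contractDeriv D p k i j = 0)
    {P : A →ₗ[ℝ] A →ₗ[ℝ] A}
    (hP : ∀ a b, P a b = ∑ e : ι × ι, p e.1 e.2 * (D e.1 a * D e.2 b)) (a b c : A) :
    compProd P P a b c = coboundaryTwo (secondStarTerm D p) a b c := by
  have two : 2 * algebraMap ℝ A (1 / 2) = 1 := by
    rw [← map_ofNat (algebraMap ℝ A) 2, ← map_mul]; norm_num
  have three : 3 * algebraMap ℝ A (1 / 3) = 1 := by
    rw [← map_ofNat (algebraMap ℝ A) 3, ← map_mul]; norm_num
  set Q := contractDeriv D p with hQ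
  have hQskew : ∀ i j k, Q i j k = -Q i k j := by
    intro i j k
    simp only [hQ, contractDeriv]
    rw [← Finset.sum_neg_distrib]
    refine Finset.sum_congr rfl fun m _ => ?_
    rw [hskew j k, map_neg, mul_neg]
  -- the parts of order two
  set U := ∑ e : ι × ι, ∑ e' : ι × ι,
    p e.1 e.2 * p e'.1 e'.2 * (D e.1 (D e'.1 a) * D e.2 b * D e'.2 c) with hU
  set V := ∑ e : ι × ι, ∑ e' : ι × ι,
    p e.1 e.2 * p e'.1 e'.2 * (D e.1 a * D e.2 (D e'.1 b) * D e'.2 c) with hV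
  set W := ∑ e : ι × ι, ∑ e' : ι × ι,
    p e.1 e.2 * p e'.1 e'.2 * (D e.1 a * D e'.1 b * D e.2 (D e'.2 c)) with hW
  -- Exchanging `e` and `e'` gives each sum a second form. The coboundary produces `U` and `W` once
  -- in each form, which the factor `1/2` compensates.
  have hU' : U = ∑ e : ι × ι, ∑ e' : ι × ι,
      p e.1 e.2 * p e'.1 e'.2 * (D e.1 (D e'.1 a) * D e'.2 b * D e.2 c) := by
    rw [hU, Finset.sum_comm]
    refine Finset.sum_congr rfl fun e _ => Finset.sum_congr rfl fun e' _ => ?_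
    rw [hcomm e'.1 e.1]
    ring
  have hV' : V = ∑ e : ι × ι, ∑ e' : ι × ι,
      p e.1 e.2 * p e'.1 e'.2 * (D e'.1 a * D e.1 (D e'.2 b) * D e.2 c) := by
    rw [hV, Finset.sum_comm]
    refine Finset.sum_congr rfl fun e _ => Finset.sum_congr rfl fun e' _ => ?_
    rw [hcomm e'.2 e.1]
    ring
  have hW' : W = ∑ e : ι × ι, ∑ e' : ι × ι,
      p e.1 e.2 * p e'.1 e'.2 * (D e'.1 a * D e.1 b * D e.2 (D e'.2 c)) := by
    rw [hW, Finset.sum_comm]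
    refine Finset.sum_congr rfl fun e _ => Finset.sum_congr rfl fun e' _ => ?_
    rw [hcomm e'.2 e.2]
    ring
  -- the parts of order one
  have hR : ∑ e : ι × ι, ∑ e' : ι × ι,
      p e.1 e.2 * D e.1 (p e'.1 e'.2) * (D e'.1 a * D e'.2 b * D e.2 c) =
      ∑ x, ∑ y, ∑ z, Q z x y * (D x a * D y b * D z c) := by
    simp only [Fintype.sum_prod_type, hQ, contractDeriv, Finset.sum_mul]
    calc _ = ∑ j, ∑ i, ∑ x, ∑ y, p i j * D i (p x y) * (D x a * D y b * D j c) :=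
          Finset.sum_comm
      _ = ∑ j, ∑ x, ∑ i, ∑ y, p i j * D i (p x y) * (D x a * D y b * D j c) :=
          Finset.sum_congr rfl fun j _ => Finset.sum_comm
      _ = ∑ x, ∑ j, ∑ i, ∑ y, p i j * D i (p x y) * (D x a * D y b * D j c) :=
          Finset.sum_comm
      _ = ∑ x, ∑ j, ∑ y, ∑ i, p i j * D i (p x y) * (D x a * D y b * D j c) :=
          Finset.sum_congr rfl fun x _ => Finset.sum_congr rfl fun j _ => Finset.sum_comm
      _ = _ := Finset.sum_congr rfl fun x _ => Finset.sum_comm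
  have hS : ∑ e : ι × ι, ∑ e' : ι × ι,
      p e.1 e.2 * D e.2 (p e'.1 e'.2) * (D e.1 a * D e'.1 b * D e'.2 c) =
      -∑ x, ∑ y, ∑ z, Q x y z * (D x a * D y b * D z c) := by
    simp only [Fintype.sum_prod_type, hQ, contractDeriv, Finset.sum_mul]
    rw [← Finset.sum_neg_distrib]
    refine Finset.sum_congr rfl fun x _ => ?_
    rw [Finset.sum_comm, ← Finset.sum_neg_distrib]
    refine Finset.sum_congr rfl fun y _ => ?_
    rw [Finset.sum_comm, ← Finset.sum_neg_distrib]
    refine Finset.sum_congr rfl fun z _ => ?_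
    rw [← Finset.sum_neg_distrib]
    refine Finset.sum_congr rfl fun i _ => ?_
    rw [hskew x i]
    ring
  have hL₁ : P (P a b) c = (∑ x, ∑ y, ∑ z, Q z x y * (D x a * D y b * D z c)) + U + V := by
    rw [← hR, hU', hV', ← Finset.sum_add_distrib, ← Finset.sum_add_distrib, hP]
    refine Finset.sum_congr rfl fun e _ => ?_
    rw [← Finset.sum_add_distrib, ← Finset.sum_add_distrib, hP, map_sum, Finset.sum_mul,
      Finset.mul_sum]
    refine Finset.sum_congr rfl fun e' _ => ?_
    rw [hD, hD]
    ring
  have hL₂ : P a (P b c) = -(∑ x, ∑ y, ∑ z, Q x y z * (D x a * D y b * D z c)) + V + W := by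
    rw [← hS, hV, hW, ← Finset.sum_add_distrib, ← Finset.sum_add_distrib, hP]
    refine Finset.sum_congr rfl fun e _ => ?_
    rw [← Finset.sum_add_distrib, ← Finset.sum_add_distrib, hP, map_sum, Finset.mul_sum,
      Finset.mul_sum]
    refine Finset.sum_congr rfl fun e' _ => ?_
    rw [hD, hD]
    ring
  have hG₂ : coboundaryTwo (∑ e : ι × ι, ∑ e' : ι × ι,
      scaleCochain (algebraMap ℝ A (1 / 2) * (p e.1 e.2 * p e'.1 e'.2))
        (cupProd (D e.1 ∘ₗ D e'.1) (D e.2 ∘ₗ D e'.2))) a b c = U - W := by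
    have : ∀ e e' : ι × ι, coboundaryTwo
        (scaleCochain (algebraMap ℝ A (1 / 2) * (p e.1 e.2 * p e'.1 e'.2))
          (cupProd (D e.1 ∘ₗ D e'.1) (D e.2 ∘ₗ D e'.2))) a b c =
        algebraMap ℝ A (1 / 2) *
          (p e.1 e.2 * p e'.1 e'.2 * (D e.1 (D e'.1 a) * D e.2 b * D e'.2 c)
          + p e.1 e.2 * p e'.1 e'.2 * (D e.1 (D e'.1 a) * D e'.2 b * D e.2 c)
          - (p e.1 e.2 * p e'.1 e'.2 * (D e.1 a * D e'.1 b * D e.2 (D e'.2 c))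
          + p e.1 e.2 * p e'.1 e'.2 * (D e'.1 a * D e.1 b * D e.2 (D e'.2 c)))) := by
      intro e e'
      rw [coboundaryTwo_scaleCochain, coboundaryTwo_cupProd_comp_comp hD]
      ring
    simp only [coboundaryTwo_sum, this]
    simp only [← Finset.mul_sum, Finset.sum_add_distrib, Finset.sum_sub_distrib]
    rw [← hU, ← hU', ← hW, ← hW']
    linear_combination (U - W) * two
  have hG₁ : coboundaryTwo (∑ j, ∑ k, ∑ l,
      scaleCochain (algebraMap ℝ A (1 / 3) * Q j k l)
        (cupProd (D k) (D j ∘ₗ D l) - cupProd (D j ∘ₗ D k) (D l))) a b c =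
      ∑ x, ∑ y, ∑ z, algebraMap ℝ A (1 / 3) * ((Q y x z + Q z x y + Q x y z + Q y x z) *
        (D x a * D y b * D z c)) := by
    have : ∀ j k l, coboundaryTwo (scaleCochain (algebraMap ℝ A (1 / 3) * Q j k l)
        (cupProd (D k) (D j ∘ₗ D l) - cupProd (D j ∘ₗ D k) (D l))) a b c =
        algebraMap ℝ A (1 / 3) * (Q j k l * (D k a * D j b * D l c)) +
        algebraMap ℝ A (1 / 3) * (Q j k l * (D k a * D l b * D j c)) +
        algebraMap ℝ A (1 / 3) * (Q j k l * (D j a * D k b * D l c)) +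
        algebraMap ℝ A (1 / 3) * (Q j k l * (D k a * D j b * D l c)) := by
      intro j k l
      rw [coboundaryTwo_scaleCochain, coboundaryTwo_cupProd_sub hD]
      ring
    simp only [coboundaryTwo_sum, this, add_mul, mul_add, Finset.sum_add_distrib]
    congr 1
    · congr 1
      congr 1
      · exact Finset.sum_comm
      · rw [Finset.sum_comm]
        exact Finset.sum_congr rfl fun _ _ => Finset.sum_comm
    · exact Finset.sum_comm
  rw [compProd, hL₁, hL₂, secondStarTerm, coboundaryTwo_add, hG₂, hG₁]
  have key : (∑ x, ∑ y, ∑ z, Q z x y * (D x a * D y b * D z c)) +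
      (∑ x, ∑ y, ∑ z, Q x y z * (D x a * D y b * D z c)) =
      ∑ x, ∑ y, ∑ z, algebraMap ℝ A (1 / 3) * ((Q y x z + Q z x y + Q x y z + Q y x z) *
        (D x a * D y b * D z c)) := by
    simp only [← Finset.sum_add_distrib]
    refine Finset.sum_congr rfl fun x _ => Finset.sum_congr rfl fun y _ =>
      Finset.sum_congr rfl fun z _ => ?_
    -- Skewness and Jacobi give `2 Q y x z = 2 (Q x y z + Q z x y)`, so the bracket is three times
    -- the required coefficient: this is the origin of `1/3`.
    have h₁ := hjac x y z
    have h₂ := hQskew y z x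
    linear_combination (D x a * D y b * D z c) * (2 * algebraMap ℝ A (1 / 3) * h₁
      - 2 * algebraMap ℝ A (1 / 3) * h₂ - (Q z x y + Q x y z) * three)
  linear_combination key

end ConstantDerivations

end

noncomputable section

/-! ## Smooth dependence of integrals on a parameter, and Hadamard's lemma -/

section ParametricIntegral

open MeasureTheory

variable {E : Type} [NormedAddCommGroup E] [NormedSpace ℝ E] [ProperSpace E]

lemma hasFDerivAt_intervalIntegral_of_contDiff {F : Type} [NormedAddCommGroup F]
    [NormedSpace ℝ F] [CompleteSpace F] {g : E × ℝ → F} (hg : ContDiff ℝ 1 g) (x : E) :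
    HasFDerivAt (fun x => ∫ t in (0 : ℝ)..1, g (x, t))
      (∫ t in (0 : ℝ)..1, (fderiv ℝ g (x, t)).comp (ContinuousLinearMap.inl ℝ E ℝ)) x := by
  have hc : Continuous fun q : E × ℝ =>
      (fderiv ℝ g q).comp (ContinuousLinearMap.inl ℝ E ℝ) :=
    (hg.continuous_fderiv one_ne_zero).clm_comp continuous_const
  -- Continuity of the derivative on a compact neighbourhood of `{x} × [0, 1]` supplies a constant
  -- dominating bound.
  have hK : IsCompact (Metric.closedBall x 1 ×ˢ Set.Icc (0 : ℝ) 1) :=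
    (isCompact_closedBall x 1).prod isCompact_Icc
  obtain ⟨C, hC⟩ := hK.exists_bound_of_continuousOn hc.continuousOn
  refine intervalIntegral.hasFDerivAt_integral_of_dominated_of_fderiv_le (𝕜 := ℝ)
    (F := fun x t => g (x, t)) (bound := fun _ => C)
    (F' := fun x t => (fderiv ℝ g (x, t)).comp (ContinuousLinearMap.inl ℝ E ℝ))
    (Metric.ball_mem_nhds x one_pos) ?_ ?_ ?_ ?_ ?_ ?_
  · exact Filter.Eventually.of_forall fun y =>
      (hg.continuous.comp (by fun_prop)).aestronglyMeasurable
  · exact (hg.continuous.comp (by fun_prop)).intervalIntegrable _ _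
  · exact (hc.comp (by fun_prop : Continuous fun t : ℝ => (x, t))).aestronglyMeasurable
  · refine Filter.Eventually.of_forall fun t ht y hy => hC (y, t) ⟨?_, ?_⟩
    · exact Metric.ball_subset_closedBall hy
    · rw [Set.uIoc_of_le zero_le_one] at ht
      exact ⟨ht.1.le, ht.2⟩
  · exact continuous_const.intervalIntegrable _ _
  · refine Filter.Eventually.of_forall fun t _ y _ => ?_
    have h₁ : HasFDerivAt g (fderiv ℝ g (y, t)) (y, t) :=
      (hg.differentiable one_ne_zero (y, t)).hasFDerivAt
    exact h₁.comp y (hasFDerivAt_prodMk_left y t)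

/-- The target `F` is quantified inside the induction because the derivative is an integral of the
same kind with values in `E →L[ℝ] F`. -/
lemma contDiff_intervalIntegral_of_contDiff (n : ℕ) : ∀ {F : Type} [NormedAddCommGroup F]
    [NormedSpace ℝ F] [CompleteSpace F] {g : E × ℝ → F}, ContDiff ℝ ∞ g →
    ContDiff ℝ n (fun x => ∫ t in (0 : ℝ)..1, g (x, t)) := by
  induction n with
  | zero =>
    intro F _ _ _ g hg
    refine contDiff_zero.2 (continuous_iff_continuousAt.2 fun x => ?_)
    exact (hasFDerivAt_intervalIntegral_of_contDiff (hg.of_le (by simp)) x).continuousAt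
  | succ n ih =>
    intro F _ _ _ g hg
    have h := contDiff_succ_iff_hasFDerivAt (𝕜 := ℝ) (n := n)
      (f := fun x => ∫ t in (0 : ℝ)..1, g (x, t))
    push_cast
    refine h.2 ⟨fun x => ∫ t in (0 : ℝ)..1,
      (fderiv ℝ g (x, t)).comp (ContinuousLinearMap.inl ℝ E ℝ), ?_, fun x =>
        hasFDerivAt_intervalIntegral_of_contDiff (hg.of_le (by simp)) x⟩
    exact ih (g := fun q => (fderiv ℝ g q).comp (ContinuousLinearMap.inl ℝ E ℝ))
      ((hg.fderiv_right (m := ∞) le_rfl).clm_comp contDiff_const)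

end ParametricIntegral

/-! ### Derivations and biderivations of smooth functions in coordinates -/

section SmoothFun

variable {d : ℕ}

lemma SmoothFun.differentiableAt (f : SmoothFun d) (x : EuclideanSpace ℝ (Fin d)) :
    DifferentiableAt ℝ f x := (f.contMDiff.contDiff.differentiable (by simp)) x

lemma partialDeriv_mul (i : Fin d) (f g : SmoothFun d) :
    partialDeriv i (f * g) = f * partialDeriv i g + g * partialDeriv i f := by
  ext x
  change fderiv ℝ (⇑f * ⇑g) x _ = f x * fderiv ℝ g x _ + g x * fderiv ℝ f x _
  rw [fderiv_mul (f.differentiableAt x) (g.differentiableAt x)]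
  rfl

lemma partialDeriv_comm (i j : Fin d) (f : SmoothFun d) :
    partialDeriv i (partialDeriv j f) = partialDeriv j (partialDeriv i f) := by
  ext x
  have hf : ContDiff ℝ ∞ (f : EuclideanSpace ℝ (Fin d) → ℝ) := f.contMDiff.contDiff
  have hd : DifferentiableAt ℝ (fderiv ℝ f) x :=
    (hf.fderiv_right (m := ∞) le_rfl).differentiable (by simp) x
  have key : ∀ k l : Fin d, partialDeriv k (partialDeriv l f) x =
      fderiv ℝ (fderiv ℝ f) x (EuclideanSpace.single k 1) (EuclideanSpace.single l 1) := by
    intro k l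
    change fderiv ℝ (fun y => fderiv ℝ f y (EuclideanSpace.single l 1)) x _ = _
    rw [fderiv_clm_apply hd (differentiableAt_const _)]
    simp
  rw [key, key]
  exact (hf.contDiffAt.isSymmSndFDerivAt
    (by simpa using WithTop.coe_le_coe.2 (le_top : (2 : ℕ∞) ≤ ⊤))) _ _

/-- The coordinate functions. -/
def coordFun (i : Fin d) : SmoothFun d :=
  ⟨fun x => x i, (EuclideanSpace.proj (𝕜 := ℝ) i).contDiff.contMDiff⟩

lemma partialDeriv_coordFun (i j : Fin d) :
    partialDeriv i (coordFun j) = if i = j then 1 else 0 := by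
  ext x
  change fderiv ℝ (EuclideanSpace.proj (𝕜 := ℝ) j) x _ = _
  rw [ContinuousLinearMap.fderiv]
  by_cases h : i = j
  · subst h
    simp
  · simp [h]

lemma SmoothFun.sum_apply {κ : Type*} (s : Finset κ) (f : κ → SmoothFun d)
    (x : EuclideanSpace ℝ (Fin d)) : (∑ i ∈ s, f i) x = ∑ i ∈ s, f i x :=
  map_sum (ContMDiffMap.evalRingHom x : SmoothFun d →+* ℝ) f s

/-- **Hadamard's lemma**, at an arbitrary base point. -/
lemma SmoothFun.exists_eq_add_sum (f : SmoothFun d) (x : EuclideanSpace ℝ (Fin d)) :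
    ∃ g : Fin d → SmoothFun d,
      f = algebraMap ℝ _ (f x) + ∑ i, (coordFun i - algebraMap ℝ _ (x i)) * g i := by
  have hf : ContDiff ℝ ∞ (f : EuclideanSpace ℝ (Fin d) → ℝ) := f.contMDiff.contDiff
  have hF : ∀ i, ContDiff ℝ ∞ (fun q : EuclideanSpace ℝ (Fin d) × ℝ =>
      partialDeriv i f (x + q.2 • (q.1 - x))) := fun i =>
    (partialDeriv i f).contMDiff.contDiff.comp (by fun_prop)
  obtain ⟨g, hg⟩ : ∃ g : Fin d → SmoothFun d, ∀ i y, g i y =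
      ∫ t in (0 : ℝ)..1, partialDeriv i f (x + t • (y - x)) :=
    ⟨fun i => ⟨fun y => ∫ t in (0 : ℝ)..1, partialDeriv i f (x + t • (y - x)),
      (contDiff_infty.2 fun n =>
        contDiff_intervalIntegral_of_contDiff n (hF i)).contMDiff⟩, fun _ _ => rfl⟩
  refine ⟨g, ?_⟩
  ext y
  have hy : ∀ i, ((coordFun i - algebraMap ℝ (SmoothFun d) (x i)) * g i) y =
      ∫ t in (0 : ℝ)..1, (y i - x i) * partialDeriv i f (x + t • (y - x)) := by
    intro i
    rw [intervalIntegral.integral_const_mul, ← hg]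
    rfl
  change f y = f x + (∑ i, (coordFun i - algebraMap ℝ (SmoothFun d) (x i)) * g i) y
  rw [SmoothFun.sum_apply, Finset.sum_congr rfl fun i _ => hy i]
  rw [← intervalIntegral.integral_finsetSum]
  -- Fundamental theorem of calculus along the segment from `x` to `y`.
  · have hline : ∀ t : ℝ, HasDerivAt (fun t : ℝ => f (x + t • (y - x)))
        (∑ i, (y i - x i) * partialDeriv i f (x + t • (y - x))) t := by
      intro t
      have h₁ : HasDerivAt (fun t : ℝ => x + t • (y - x)) (y - x) t := by
        simpa using ((hasDerivAt_id t).smul_const (y - x)).const_add x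
      have h₂ := (f.differentiableAt (x + t • (y - x))).hasFDerivAt.comp_hasDerivAt t h₁
      have h₃ : y - x = ∑ i, (y i - x i) • EuclideanSpace.single i (1 : ℝ) := by
        ext j
        simp [Finset.sum_apply, Pi.single_apply]
      have h₄ := congrArg (fderiv ℝ f (x + t • (y - x))) h₃
      simp only [map_sum, map_smul, smul_eq_mul] at h₄
      rw [h₄] at h₂
      exact h₂
    rw [intervalIntegral.integral_eq_sub_of_hasDerivAt (fun t _ => hline t)]
    · simp
    · refine (continuous_finsetSum _ fun i _ => continuous_const.mul ?_).intervalIntegrable _ _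
      exact (partialDeriv i f).contMDiff.continuous.comp (by fun_prop)
  · intro i _
    refine (continuous_const.mul ?_).intervalIntegrable _ _
    exact (partialDeriv i f).contMDiff.continuous.comp (by fun_prop)

/-- Derivations of `C^∞(ℝ^d)` are vector fields. -/
lemma derivation_eq_sum {δ : SmoothFun d →ₗ[ℝ] SmoothFun d}
    (hδ : ∀ a b, δ (a * b) = a * δ b + b * δ a) (f : SmoothFun d) :
    δ f = ∑ i, partialDeriv i f * δ (coordFun i) := by
  have hconst : ∀ {δ' : SmoothFun d →ₗ[ℝ] SmoothFun d},
      (∀ a b, δ' (a * b) = a * δ' b + b * δ' a) → ∀ r : ℝ, δ' (algebraMap ℝ _ r) = 0 := by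
    intro δ' hδ' r
    have h₁ := hδ' 1 1
    rw [mul_one, one_mul, left_eq_add] at h₁
    rw [Algebra.algebraMap_eq_smul_one, map_smul, h₁, smul_zero]
  ext x
  obtain ⟨g, hg⟩ := f.exists_eq_add_sum x
  -- At the base point every derivation sees only the values `g i x`. Applied to `partialDeriv i`,
  -- this identifies `g i x` with the partial derivative of `f` at `x`.
  have key : ∀ {δ' : SmoothFun d →ₗ[ℝ] SmoothFun d},
      (∀ a b, δ' (a * b) = a * δ' b + b * δ' a) →
        δ' f x = ∑ i, g i x * δ' (coordFun i) x := by
    intro δ' hδ'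
    conv_lhs => rw [hg]
    rw [map_add, hconst hδ', zero_add, map_sum, SmoothFun.sum_apply]
    refine Finset.sum_congr rfl fun i _ => ?_
    rw [hδ', map_sub, hconst hδ', sub_zero]
    change (x i - x i) * _ + g i x * _ = _
    ring
  rw [key hδ, SmoothFun.sum_apply]
  refine Finset.sum_congr rfl fun i _ => ?_
  change _ = partialDeriv i f x * δ (coordFun i) x
  rw [key (partialDeriv_mul i)]
  simp only [partialDeriv_coordFun]
  congr 1
  rw [Finset.sum_eq_single i]
  · simp
  · intro j _ hj
    rw [if_neg (Ne.symm hj)]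
    simp
  · simp

lemma IsBiderivation.apply_eq_sum {P : SmoothFun d →ₗ[ℝ] SmoothFun d →ₗ[ℝ] SmoothFun d}
    (hP : IsBiderivation P) (a b : SmoothFun d) :
    P a b = ∑ e : Fin d × Fin d,
      P (coordFun e.1) (coordFun e.2) * (partialDeriv e.1 a * partialDeriv e.2 b) := by
  have h₁ : P.flip b a = ∑ i, partialDeriv i a * P.flip b (coordFun i) :=
    derivation_eq_sum (fun a a' => hP.1 a a' b) a
  rw [LinearMap.flip_apply] at h₁
  rw [h₁, Fintype.sum_prod_type]
  refine Finset.sum_congr rfl fun i _ => ?_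
  rw [LinearMap.flip_apply, derivation_eq_sum (fun b b' => hP.2 _ b b') b, Finset.mul_sum]
  refine Finset.sum_congr rfl fun j _ => ?_
  ring

end SmoothFun

end

noncomputable section

/-! ## Differential cochains -/

section DifferentialCochains

variable {d : ℕ}

/-- The elementary differential 2-cochain `(a, b) ↦ c * ∂^I a * ∂^J b`. -/
def elemTwo (c : SmoothFun d) (I J : List (Fin d)) :
    SmoothFun d →ₗ[ℝ] SmoothFun d →ₗ[ℝ] SmoothFun d :=
  scaleCochain c (cupProd (iterPartial I) (iterPartial J))

lemma elemTwo_apply (c : SmoothFun d) (I J : List (Fin d)) (a b : SmoothFun d) :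
    elemTwo c I J a b = c * (iterPartial I a * iterPartial J b) := rfl

lemma iterPartial_nil : iterPartial ([] : List (Fin d)) = LinearMap.id := rfl

lemma iterPartial_cons (i : Fin d) (I : List (Fin d)) :
    iterPartial (i :: I) = partialDeriv i ∘ₗ iterPartial I := rfl

lemma mulLeft_comp_iterPartial_mem (a : SmoothFun d) (I : List (Fin d)) :
    LinearMap.mulLeft ℝ a ∘ₗ iterPartial I ∈ diffOneCochains d :=
  Submodule.subset_span ⟨a, I, rfl⟩

lemma iterPartial_mem (I : List (Fin d)) : iterPartial I ∈ diffOneCochains d := by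
  convert mulLeft_comp_iterPartial_mem 1 I
  ext1 a
  simp

lemma id_mem_diffOneCochains : LinearMap.id ∈ diffOneCochains d := iterPartial_mem []

lemma partialDeriv_mem (i : Fin d) : partialDeriv i ∈ diffOneCochains d := iterPartial_mem [i]

lemma cupProd_mem {f g : SmoothFun d →ₗ[ℝ] SmoothFun d} (hf : f ∈ diffOneCochains d)
    (hg : g ∈ diffOneCochains d) : cupProd f g ∈ diffTwoCochains d :=
  Submodule.subset_span ⟨f, hf, g, hg, rfl⟩

lemma mulLeft_comp_mem (φ : SmoothFun d) {f : SmoothFun d →ₗ[ℝ] SmoothFun d}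
    (hf : f ∈ diffOneCochains d) : LinearMap.mulLeft ℝ φ ∘ₗ f ∈ diffOneCochains d := by
  induction hf using Submodule.span_induction with
  | mem f h =>
    obtain ⟨a, I, rfl⟩ := h
    convert mulLeft_comp_iterPartial_mem (φ * a) I using 1
    ext1 b
    simp
  | zero => rw [LinearMap.comp_zero]; exact zero_mem _
  | add f g _ _ h₁ h₂ => rw [LinearMap.comp_add]; exact add_mem h₁ h₂
  | smul r f _ h => rw [LinearMap.comp_smul]; exact Submodule.smul_mem _ r h

lemma partialDeriv_comp_mem (i : Fin d) {f : SmoothFun d →ₗ[ℝ] SmoothFun d}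
    (hf : f ∈ diffOneCochains d) : partialDeriv i ∘ₗ f ∈ diffOneCochains d := by
  induction hf using Submodule.span_induction with
  | mem f h =>
    obtain ⟨a, I, rfl⟩ := h
    convert add_mem (mulLeft_comp_iterPartial_mem a (i :: I))
      (mulLeft_comp_iterPartial_mem (partialDeriv i a) I) using 1
    ext1 b
    simp [iterPartial_cons, partialDeriv_mul, mul_comm]
  | zero => rw [LinearMap.comp_zero]; exact zero_mem _
  | add f g _ _ h₁ h₂ => rw [LinearMap.comp_add]; exact add_mem h₁ h₂
  | smul r f _ h => rw [LinearMap.comp_smul]; exact Submodule.smul_mem _ r h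

lemma iterPartial_comp_mem (I : List (Fin d)) {f : SmoothFun d →ₗ[ℝ] SmoothFun d}
    (hf : f ∈ diffOneCochains d) : iterPartial I ∘ₗ f ∈ diffOneCochains d := by
  induction I with
  | nil => exact hf
  | cons i I ih => exact partialDeriv_comp_mem i ih

/-- The Leibniz rule moves coefficients to the left of partial derivatives. This closure keeps gauge
corrections by a differential `γ` inside the differential subcomplex. -/
lemma comp_mem {f g : SmoothFun d →ₗ[ℝ] SmoothFun d} (hf : f ∈ diffOneCochains d)
    (hg : g ∈ diffOneCochains d) : f ∘ₗ g ∈ diffOneCochains d := by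
  induction hf using Submodule.span_induction with
  | mem f h =>
    obtain ⟨a, I, rfl⟩ := h
    exact mulLeft_comp_mem a (iterPartial_comp_mem I hg)
  | zero => rw [LinearMap.zero_comp]; exact zero_mem _
  | add f g _ _ h₁ h₂ => rw [LinearMap.add_comp]; exact add_mem h₁ h₂
  | smul r f _ h => rw [LinearMap.smul_comp]; exact Submodule.smul_mem _ r h

variable {F : SmoothFun d →ₗ[ℝ] SmoothFun d →ₗ[ℝ] SmoothFun d}

lemma scaleCochain_mem (φ : SmoothFun d) (hF : F ∈ diffTwoCochains d) :
    scaleCochain φ F ∈ diffTwoCochains d := by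
  induction hF using Submodule.span_induction with
  | mem F h =>
    obtain ⟨f, hf, g, hg, rfl⟩ := h
    convert cupProd_mem (mulLeft_comp_mem φ hf) hg using 1
    ext1 a
    ext1 b
    simp [mul_assoc]
  | zero => convert zero_mem (diffTwoCochains d); ext1 a; ext1 b; simp
  | add F G _ _ h₁ h₂ => rw [scaleCochain_add]; exact add_mem h₁ h₂
  | smul r F _ h =>
    convert Submodule.smul_mem _ r h using 1
    ext1 a
    ext1 b
    simp

lemma elemTwo_mem (c : SmoothFun d) (I J : List (Fin d)) : elemTwo c I J ∈ diffTwoCochains d :=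
  scaleCochain_mem c (cupProd_mem (iterPartial_mem I) (iterPartial_mem J))

lemma flip_mem (hF : F ∈ diffTwoCochains d) : F.flip ∈ diffTwoCochains d := by
  induction hF using Submodule.span_induction with
  | mem F h =>
    obtain ⟨f, hf, g, hg, rfl⟩ := h
    convert cupProd_mem hg hf using 1
    ext1 a
    ext1 b
    simp [mul_comm]
  | zero => exact zero_mem _
  | add F G _ _ h₁ h₂ => exact add_mem h₁ h₂
  | smul r F _ h => exact Submodule.smul_mem _ r h

lemma compl₁₂_mem {f g : SmoothFun d →ₗ[ℝ] SmoothFun d} (hF : F ∈ diffTwoCochains d)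
    (hf : f ∈ diffOneCochains d) (hg : g ∈ diffOneCochains d) :
    F.compl₁₂ f g ∈ diffTwoCochains d := by
  induction hF using Submodule.span_induction with
  | mem F h =>
    obtain ⟨f', hf', g', hg', rfl⟩ := h
    exact cupProd_mem (comp_mem hf' hf) (comp_mem hg' hg)
  | zero => exact zero_mem _
  | add F G _ _ h₁ h₂ => exact add_mem h₁ h₂
  | smul r F _ h => exact Submodule.smul_mem _ r h

lemma compr₂_partialDeriv_mem (i : Fin d) (hF : F ∈ diffTwoCochains d) :
    F.compr₂ (partialDeriv i) ∈ diffTwoCochains d := by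
  induction hF using Submodule.span_induction with
  | mem F h =>
    obtain ⟨f, hf, g, hg, rfl⟩ := h
    convert add_mem (cupProd_mem hf (partialDeriv_comp_mem i hg))
      (cupProd_mem (partialDeriv_comp_mem i hf) hg) using 1
    ext1 a
    ext1 b
    simp [partialDeriv_mul, mul_comm]
  | zero => convert zero_mem (diffTwoCochains d); ext1 a; ext1 b; simp
  | add F G _ _ h₁ h₂ => convert add_mem h₁ h₂ using 1; ext1 a; ext1 b; simp
  | smul r F _ h => convert Submodule.smul_mem _ r h using 1; ext1 a; ext1 b; simp

lemma compr₂_mem {f : SmoothFun d →ₗ[ℝ] SmoothFun d} (hF : F ∈ diffTwoCochains d)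
    (hf : f ∈ diffOneCochains d) : F.compr₂ f ∈ diffTwoCochains d := by
  induction hf using Submodule.span_induction with
  | mem f h =>
    obtain ⟨c, I, rfl⟩ := h
    refine scaleCochain_mem c (F := F.compr₂ (iterPartial I)) ?_
    induction I with
    | nil => exact hF
    | cons i I ih => exact compr₂_partialDeriv_mem i ih
  | zero => exact zero_mem _
  | add f g _ _ h₁ h₂ => exact add_mem h₁ h₂
  | smul r f _ h => exact Submodule.smul_mem _ r h

lemma mul_mem_diffTwoCochains : LinearMap.mul ℝ (SmoothFun d) ∈ diffTwoCochains d :=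
  cupProd_mem id_mem_diffOneCochains id_mem_diffOneCochains

lemma diffTwoCochains_sub_mem {G : SmoothFun d →ₗ[ℝ] SmoothFun d →ₗ[ℝ] SmoothFun d}
    (hF : F ∈ diffTwoCochains d) (hG : G ∈ diffTwoCochains d) : F - G ∈ diffTwoCochains d := by
  have e : F - G = F + (-1 : ℝ) • G := by
    ext1 a
    ext1 b
    simp [sub_eq_add_neg]
  rw [e]
  exact Submodule.add_mem _ hF (Submodule.smul_mem _ _ hG)

lemma coboundaryOne_mem {γ : SmoothFun d →ₗ[ℝ] SmoothFun d} (hγ : γ ∈ diffOneCochains d) :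
    coboundaryOne γ ∈ diffTwoCochains d := by
  have e : coboundaryOne γ = cupProd LinearMap.id γ - (LinearMap.mul ℝ (SmoothFun d)).compr₂ γ +
    cupProd γ LinearMap.id := by
    ext1 a
    ext1 b
    rfl
  rw [e]
  exact Submodule.add_mem _ (diffTwoCochains_sub_mem (cupProd_mem id_mem_diffOneCochains hγ)
    (compr₂_mem mul_mem_diffTwoCochains hγ)) (cupProd_mem hγ id_mem_diffOneCochains)

lemma gaugeCorrection_mem {γ : SmoothFun d →ₗ[ℝ] SmoothFun d} (hF : F ∈ diffTwoCochains d)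
    (hγ : γ ∈ diffOneCochains d) : gaugeCorrection F γ ∈ diffTwoCochains d := by
  have hid := id_mem_diffOneCochains (d := d)
  have e : gaugeCorrection F γ =
      cupProd γ γ + F.compl₁₂ γ LinearMap.id + F.compl₁₂ LinearMap.id γ
        - (cupProd γ LinearMap.id + cupProd LinearMap.id γ + F).compr₂ γ
        + (LinearMap.mul ℝ (SmoothFun d)).compr₂ (γ ∘ₗ γ) := by
    ext1 a
    ext1 b
    rfl
  have h₁ : cupProd γ γ + F.compl₁₂ γ LinearMap.id + F.compl₁₂ LinearMap.id γ ∈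
      diffTwoCochains d :=
    Submodule.add_mem _ (Submodule.add_mem _ (cupProd_mem hγ hγ) (compl₁₂_mem hF hγ hid))
      (compl₁₂_mem hF hid hγ)
  have h₂ : cupProd γ LinearMap.id + cupProd LinearMap.id γ + F ∈ diffTwoCochains d :=
    Submodule.add_mem _ (Submodule.add_mem _ (cupProd_mem hγ hid) (cupProd_mem hid hγ)) hF
  rw [e]
  exact Submodule.add_mem _ (diffTwoCochains_sub_mem h₁ (compr₂_mem h₂ hγ))
    (compr₂_mem mul_mem_diffTwoCochains (comp_mem hγ hγ))

lemma secondStarTerm_mem (p : Fin d → Fin d → SmoothFun d) :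
    secondStarTerm partialDeriv p ∈ diffTwoCochains d := by
  have h := partialDeriv_mem (d := d)
  unfold secondStarTerm
  refine Submodule.add_mem _ ?_ ?_
  · refine Submodule.sum_mem _ fun e _ => Submodule.sum_mem _ fun e' _ => scaleCochain_mem _ ?_
    exact cupProd_mem (comp_mem (h _) (h _)) (comp_mem (h _) (h _))
  · refine Submodule.sum_mem _ fun j _ => Submodule.sum_mem _ fun k _ =>
      Submodule.sum_mem _ fun l _ => scaleCochain_mem _ ?_
    exact diffTwoCochains_sub_mem (cupProd_mem (h _) (comp_mem (h _) (h _)))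
      (cupProd_mem (comp_mem (h _) (h _)) (h _))

/-- The differential 2-cochains spanned by the elementary ones of total order `n`. -/
def homogeneousTwo (d n : ℕ) :
    Submodule ℝ (SmoothFun d →ₗ[ℝ] SmoothFun d →ₗ[ℝ] SmoothFun d) :=
  Submodule.span ℝ {F | ∃ c I J, I.length + J.length = n ∧ F = elemTwo c I J}

lemma homogeneousTwo_le (n : ℕ) : homogeneousTwo d n ≤ diffTwoCochains d := by
  refine Submodule.span_le.2 ?_
  rintro _ ⟨c, I, J, -, rfl⟩
  exact elemTwo_mem c I J

lemma diffTwoCochains_le_iSup : diffTwoCochains d ≤ ⨆ n, homogeneousTwo d n := by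
  refine Submodule.span_le.2 ?_
  rintro _ ⟨f, hf, g, hg, rfl⟩
  change cupProd f g ∈ ⨆ n, homogeneousTwo d n
  induction hf using Submodule.span_induction with
  | mem f h =>
    obtain ⟨a, I, rfl⟩ := h
    induction hg using Submodule.span_induction with
    | mem g h =>
      obtain ⟨b, J, rfl⟩ := h
      refine Submodule.mem_iSup_of_mem (I.length + J.length)
        (Submodule.subset_span ⟨a * b, I, J, rfl, ?_⟩)
      ext1 x
      ext1 y
      simp only [cupProd_apply, elemTwo_apply, LinearMap.comp_apply, LinearMap.mulLeft_apply]
      ring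
    | zero => convert zero_mem (⨆ n, homogeneousTwo d n); ext1 x; ext1 y; simp
    | add f g _ _ h₁ h₂ =>
      convert add_mem h₁ h₂ using 1; ext1 x; ext1 y; simp [mul_add]
    | smul r f _ h => convert Submodule.smul_mem _ r h using 1; ext1 x; ext1 y; simp
  | zero => convert zero_mem (⨆ n, homogeneousTwo d n); ext1 x; ext1 y; simp
  | add f g _ _ h₁ h₂ => convert add_mem h₁ h₂ using 1; ext1 x; ext1 y; simp [add_mul]
  | smul r f _ h => convert Submodule.smul_mem _ r h using 1; ext1 x; ext1 y; simp

lemma diffTwoCochains_le_span_elemTwo :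
    diffTwoCochains d ≤ Submodule.span ℝ {F | ∃ c I J, F = elemTwo (d := d) c I J} := by
  refine diffTwoCochains_le_iSup.trans (iSup_le fun n => Submodule.span_mono ?_)
  rintro _ ⟨c, I, J, -, rfl⟩
  exact ⟨c, I, J, rfl⟩

/-- Uniqueness of the decomposition is not needed: rescaling the arguments of the symbols separates
the orders later. -/
lemma exists_eq_sum_homogeneousTwo (hF : F ∈ diffTwoCochains d) :
    ∃ (s : Finset ℕ) (G : ℕ → SmoothFun d →ₗ[ℝ] SmoothFun d →ₗ[ℝ] SmoothFun d),
      (∀ n, G n ∈ homogeneousTwo d n) ∧ F = ∑ n ∈ s, G n := by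
  obtain ⟨G, hG⟩ := (Submodule.mem_iSup_iff_exists_finsupp _ _).1 (diffTwoCochains_le_iSup hF)
  exact ⟨G.support, G, hG.1, hG.2.symm⟩

end DifferentialCochains

end

noncomputable section

/-! ## Symbols of differential cochains -/

section Symbol

variable {d : ℕ}

/-- The exponential function `x ↦ exp (∑ u i * x i)`. -/
def expFun (u : Fin d → ℝ) : SmoothFun d :=
  ⟨fun x => Real.exp (∑ i, u i * x i),
    (Real.contDiff_exp.comp (ContDiff.sum fun i _ => contDiff_const.mul
      (EuclideanSpace.proj (𝕜 := ℝ) i).contDiff)).contMDiff⟩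

lemma expFun_apply (u : Fin d → ℝ) (x : EuclideanSpace ℝ (Fin d)) :
    expFun u x = Real.exp (∑ i, u i * x i) := rfl

lemma expFun_add (u v : Fin d → ℝ) : expFun (u + v) = expFun u * expFun v := by
  ext x
  change Real.exp _ = Real.exp _ * Real.exp _
  rw [← Real.exp_add, ← Finset.sum_add_distrib]
  simp only [Pi.add_apply, add_mul]

lemma expFun_mul_expFun_neg (u : Fin d → ℝ) : expFun u * expFun (-u) = 1 := by
  rw [← expFun_add, add_neg_cancel]
  ext x
  simp [expFun_apply]

lemma partialDeriv_expFun (i : Fin d) (u : Fin d → ℝ) :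
    partialDeriv i (expFun u) = u i • expFun u := by
  ext x
  have h : HasFDerivAt (fun x : EuclideanSpace ℝ (Fin d) => ∑ j, u j * x j)
      (∑ j, u j • EuclideanSpace.proj (𝕜 := ℝ) j) x :=
    HasFDerivAt.fun_sum fun j _ => (EuclideanSpace.proj (𝕜 := ℝ) j).hasFDerivAt.const_mul (u j)
  change fderiv ℝ (fun x : EuclideanSpace ℝ (Fin d) => Real.exp (∑ j, u j * x j)) x _ =
    u i * Real.exp _
  rw [h.exp.fderiv]
  simp [mul_comm]

lemma iterPartial_expFun (I : List (Fin d)) (u : Fin d → ℝ) :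
    iterPartial I (expFun u) = (I.map u).prod • expFun u := by
  induction I with
  | nil => simp [iterPartial_nil]
  | cons i I ih =>
    rw [iterPartial_cons, LinearMap.comp_apply, ih, map_smul, partialDeriv_expFun, smul_smul,
      List.map_cons, List.prod_cons, mul_comm]

/-- The symbol of a 2-cochain: `F(e^u, e^v) = symbol u v F * e^{u + v}`. -/
def symbol (u v : Fin d → ℝ) :
    (SmoothFun d →ₗ[ℝ] SmoothFun d →ₗ[ℝ] SmoothFun d) →ₗ[ℝ] SmoothFun d :=
  LinearMap.mulLeft ℝ (expFun (-(u + v))) ∘ₗ LinearMap.applyₗ (expFun v) ∘ₗ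
    LinearMap.applyₗ (expFun u)

lemma symbol_apply (u v : Fin d → ℝ) (F : SmoothFun d →ₗ[ℝ] SmoothFun d →ₗ[ℝ] SmoothFun d) :
    symbol u v F = expFun (-u) * expFun (-v) * F (expFun u) (expFun v) := by
  rw [← expFun_add, ← neg_add]
  rfl

lemma symbol_elemTwo (u v : Fin d → ℝ) (c : SmoothFun d) (I J : List (Fin d)) :
    symbol u v (elemTwo c I J) = ((I.map u).prod * (J.map v).prod) • c := by
  rw [symbol_apply, elemTwo_apply, iterPartial_expFun, iterPartial_expFun, smul_mul_smul_comm,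
    mul_smul_comm, mul_smul_comm]
  congr 1
  linear_combination c * expFun_mul_expFun_neg u * expFun v * expFun (-v) +
    c * expFun_mul_expFun_neg v

lemma symbol_coboundaryOne (u v : Fin d → ℝ) (γ : SmoothFun d →ₗ[ℝ] SmoothFun d) :
    symbol u v (coboundaryOne γ) = expFun (-u) * γ (expFun u) -
      expFun (-(u + v)) * γ (expFun (u + v)) + expFun (-v) * γ (expFun v) := by
  rw [symbol_apply, coboundaryOne_apply, expFun_add u v, neg_add, expFun_add (-u)]
  linear_combination expFun (-v) * γ (expFun v) * expFun_mul_expFun_neg u +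
    expFun (-u) * γ (expFun u) * expFun_mul_expFun_neg v

variable {F : SmoothFun d →ₗ[ℝ] SmoothFun d →ₗ[ℝ] SmoothFun d}

/-- Since `e^u e^v = e^{u+v}`, the symbol is a group 2-cocycle on `ℝ^d` with trivial action on the
coefficients. -/
lemma IsTwoCocycle.symbol_cocycle (hF : IsTwoCocycle F) (u v w : Fin d → ℝ) :
    symbol v w F - symbol (u + v) w F + symbol u (v + w) F - symbol u v F = 0 := by
  have h := hF (expFun u) (expFun v) (expFun w)
  simp only [coboundaryTwo, ← expFun_add] at h
  simp only [symbol_apply, neg_add, expFun_add (-u), expFun_add (-v)]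
  linear_combination expFun (-u) * expFun (-v) * expFun (-w) * h -
    expFun (-v) * expFun (-w) * F (expFun v) (expFun w) * expFun_mul_expFun_neg u +
    expFun (-u) * expFun (-v) * F (expFun u) (expFun v) * expFun_mul_expFun_neg w

lemma symbol_smul_smul {n : ℕ} (hF : F ∈ homogeneousTwo d n) (r : ℝ) (u v : Fin d → ℝ) :
    symbol (r • u) (r • v) F = r ^ n • symbol u v F := by
  have hprod : ∀ (I : List (Fin d)) (u : Fin d → ℝ),
      (I.map (r • u)).prod = r ^ I.length * (I.map u).prod := by
    intro I u
    induction I with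
    | nil => simp
    | cons i I ih =>
      rw [List.map_cons, List.map_cons, List.prod_cons, List.prod_cons, ih, List.length_cons,
        Pi.smul_apply, smul_eq_mul]
      ring
  induction hF using Submodule.span_induction with
  | mem F h =>
    obtain ⟨c, I, J, h, rfl⟩ := h
    rw [symbol_elemTwo, symbol_elemTwo, hprod, hprod, smul_smul, ← h]
    congr 1
    ring
  | zero => simp
  | add F G _ _ h₁ h₂ => rw [map_add, map_add, h₁, h₂, smul_add]
  | smul q F _ h => rw [map_smul, map_smul, h, smul_comm]

lemma symbol_eq_add_of_mem_homogeneousTwo_one (hF : F ∈ homogeneousTwo d 1) (u v : Fin d → ℝ) :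
    symbol u v F = symbol u 0 F + symbol 0 v F := by
  induction hF using Submodule.span_induction with
  | mem F h =>
    obtain ⟨c, I, J, h, rfl⟩ := h
    simp only [symbol_elemTwo]
    rcases I with _ | ⟨i, I⟩
    · obtain ⟨j, rfl⟩ := List.length_eq_one_iff.1 (by simpa using h : J.length = 1)
      simp
    · simp only [List.length_cons] at h
      obtain rfl : I = [] := List.length_eq_zero_iff.1 (by omega)
      obtain rfl : J = [] := List.length_eq_zero_iff.1 (by omega)
      simp
  | zero => simp
  | add F G _ _ h₁ h₂ => rw [map_add, map_add, map_add, h₁, h₂]; abel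
  | smul q F _ h => rw [map_smul, map_smul, map_smul, h, smul_add]

/-- On the diagonal `c ∂^I ⊗ ∂^J` has the symbol of the operator `c ∂^I ∂^J`. These operators are
the primitives of symmetric cocycles, up to constants. -/
lemma exists_symbol_diagonal (hF : F ∈ diffTwoCochains d) :
    ∃ γ ∈ diffOneCochains d, ∀ u, expFun (-u) * γ (expFun u) = symbol u u F := by
  replace hF := diffTwoCochains_le_span_elemTwo hF
  induction hF using Submodule.span_induction with
  | mem F h =>
    obtain ⟨c, I, J, rfl⟩ := h
    refine ⟨_, mulLeft_comp_iterPartial_mem c (I ++ J), fun u => ?_⟩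
    rw [symbol_elemTwo, LinearMap.comp_apply, iterPartial_expFun, LinearMap.mulLeft_apply,
      List.map_append, List.prod_append, mul_smul_comm, mul_smul_comm]
    congr 1
    linear_combination c * expFun_mul_expFun_neg u
  | zero => exact ⟨0, zero_mem _, fun u => by simp⟩
  | add F G _ _ h₁ h₂ =>
    obtain ⟨γ₁, hγ₁, h₁⟩ := h₁
    obtain ⟨γ₂, hγ₂, h₂⟩ := h₂
    refine ⟨γ₁ + γ₂, add_mem hγ₁ hγ₂, fun u => ?_⟩
    rw [LinearMap.add_apply, mul_add, h₁, h₂, map_add]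
  | smul q F _ h =>
    obtain ⟨γ, hγ, h⟩ := h
    refine ⟨q • γ, Submodule.smul_mem _ q hγ, fun u => ?_⟩
    rw [LinearMap.smul_apply, mul_smul_comm, h, map_smul]

/-! ### A differential 2-cochain is determined by its symbol -/

lemma iterPartial_perm {I J : List (Fin d)} (h : I.Perm J) : iterPartial I = iterPartial J := by
  induction h with
  | nil => rfl
  | cons i _ ih => rw [iterPartial_cons, iterPartial_cons, ih]
  | swap i j I =>
    ext1 a
    exact partialDeriv_comm j i _
  | trans _ _ h₁ h₂ => exact h₁.trans h₂

lemma list_prod_X_eq_monomial {σ : Type*} [DecidableEq σ] (l : List σ) :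
    (l.map (MvPolynomial.X (R := ℝ))).prod =
      MvPolynomial.monomial (Multiset.toFinsupp (l : Multiset σ)) 1 := by
  induction l with
  | nil => simp
  | cons i l ih =>
    rw [List.map_cons, List.prod_cons, ih, MvPolynomial.X, MvPolynomial.monomial_mul,
      ← Multiset.cons_coe, ← Multiset.singleton_add, map_add, Multiset.toFinsupp_singleton,
      one_mul]

/-- The functional on polynomials in `2d` variables given by `u^I v^J ↦ ∂^I a(x) * ∂^J b(x)`. -/
def jetPairing (a b : SmoothFun d) (x : EuclideanSpace ℝ (Fin d)) :
    MvPolynomial (Fin d ⊕ Fin d) ℝ →ₗ[ℝ] ℝ :=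
  (MvPolynomial.basisMonomials (Fin d ⊕ Fin d) ℝ).constr ℝ fun m =>
    iterPartial ((Finsupp.toMultiset m).toList.filterMap Sum.getLeft?) a x *
      iterPartial ((Finsupp.toMultiset m).toList.filterMap Sum.getRight?) b x

lemma jetPairing_prod_X (a b : SmoothFun d) (x : EuclideanSpace ℝ (Fin d)) (I J : List (Fin d)) :
    jetPairing a b x (((I.map Sum.inl ++ J.map Sum.inr).map MvPolynomial.X).prod) =
      iterPartial I a x * iterPartial J b x := by
  rw [list_prod_X_eq_monomial, ← congrFun (MvPolynomial.coe_basisMonomials _ _) _, jetPairing,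
    Module.Basis.constr_basis]
  have hp : (Finsupp.toMultiset (Multiset.toFinsupp
      ((I.map Sum.inl ++ J.map Sum.inr : List (Fin d ⊕ Fin d)) :
        Multiset (Fin d ⊕ Fin d)))).toList.Perm (I.map Sum.inl ++ J.map Sum.inr) := by
    rw [Multiset.toFinsupp_toMultiset]
    exact Multiset.coe_eq_coe.1 (Multiset.coe_toList _)
  -- `Multiset.toList` picks an arbitrary order, harmless because partial derivatives commute.
  rw [iterPartial_perm (hp.filterMap _), iterPartial_perm (hp.filterMap _)]
  have e₁ : (I.map Sum.inl ++ J.map Sum.inr).filterMap Sum.getLeft? = I := by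
    simp [List.filterMap_append, List.filterMap_map, Function.comp_def]
  have e₂ : (I.map Sum.inl ++ J.map Sum.inr).filterMap Sum.getRight? = J := by
    simp [List.filterMap_append, List.filterMap_map, Function.comp_def]
  rw [e₁, e₂]

/-- One polynomial both evaluates to the symbol at `x` and determines all values `F a b x` through
`jetPairing`. A zero symbol therefore forces `F = 0`, without a normal form for cochains. -/
lemma exists_polynomial_symbol (hF : F ∈ diffTwoCochains d) (x : EuclideanSpace ℝ (Fin d)) :
    ∃ p : MvPolynomial (Fin d ⊕ Fin d) ℝ,
      (∀ w : Fin d ⊕ Fin d → ℝ,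
        MvPolynomial.eval w p = symbol (w ∘ Sum.inl) (w ∘ Sum.inr) F x) ∧
      ∀ a b, F a b x = jetPairing a b x p := by
  replace hF := diffTwoCochains_le_span_elemTwo hF
  induction hF using Submodule.span_induction with
  | mem F h =>
    obtain ⟨c, I, J, rfl⟩ := h
    refine ⟨c x • ((I.map Sum.inl ++ J.map Sum.inr).map MvPolynomial.X).prod, fun w => ?_,
      fun a b => ?_⟩
    · rw [symbol_elemTwo, MvPolynomial.smul_eval, map_list_prod]
      simp [Function.comp_def, mul_comm]
    · rw [map_smul, jetPairing_prod_X]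
      rfl
  | zero => exact ⟨0, fun w => by simp, fun a b => by simp⟩
  | add F G _ _ h₁ h₂ =>
    obtain ⟨p, hp, hp'⟩ := h₁
    obtain ⟨q, hq, hq'⟩ := h₂
    refine ⟨p + q, fun w => ?_, fun a b => ?_⟩
    · rw [map_add, hp, hq, map_add]
      rfl
    · rw [map_add, ← hp', ← hq']
      rfl
  | smul r F _ h =>
    obtain ⟨p, hp, hp'⟩ := h
    refine ⟨r • p, fun w => ?_, fun a b => ?_⟩
    · rw [MvPolynomial.smul_eval, hp, map_smul]
      rfl
    · rw [map_smul, ← hp']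
      rfl

lemma eq_zero_of_symbol_eq_zero (hF : F ∈ diffTwoCochains d) (h : ∀ u v, symbol u v F = 0) :
    F = 0 := by
  ext a b x
  obtain ⟨p, hp, hp'⟩ := exists_polynomial_symbol hF x
  have : p = 0 := MvPolynomial.funext fun w => by rw [hp, h, map_zero]; rfl
  rw [hp', this, map_zero]
  rfl

/-! ### Symmetric differential cocycles are coboundaries -/

/-- At each point the sum is a real polynomial in `r` that vanishes identically. -/
lemma eq_zero_of_sum_pow_smul_eq_zero {s : Finset ℕ} {a : ℕ → SmoothFun d}
    (h : ∀ r : ℝ, ∑ n ∈ s, r ^ n • a n = 0) {n : ℕ} (hn : n ∈ s) : a n = 0 := by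
  ext x
  have hp : ∑ n ∈ s, Polynomial.monomial n (a n x) = 0 := by
    refine Polynomial.funext fun r => ?_
    have h' := congrArg (fun f : SmoothFun d => f x) (h r)
    simp only [SmoothFun.sum_apply] at h'
    rw [Polynomial.eval_finsetSum, Polynomial.eval_zero]
    refine Eq.trans (Finset.sum_congr rfl fun n _ => ?_) h'
    rw [Polynomial.eval_monomial, mul_comm]
    rfl
  have := congrArg (fun p => Polynomial.coeff p n) hp
  simpa [Polynomial.finsetSum_coeff, Polynomial.coeff_monomial, hn] using this

/-- If `s` is homogeneous of degree `n`, the first term is `2^n s(u, v)`, so `(2 - 2^n) s(u, v) =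
s(u, u) + s(v, v) - s(u + v, u + v)`, a coboundary of the diagonal. -/
lemma doubling_of_symm_cocycle {V M : Type*} [AddCommGroup V] [AddCommGroup M] {s : V → V → M}
    (hs : ∀ u v, s u v = s v u)
    (hc : ∀ u v w, s v w - s (u + v) w + s u (v + w) - s u v = 0) (u v : V) :
    s (u + u) (v + v) + s u u + s v v = 2 • s u v + s (u + v) (u + v) := by
  have h₁ := hc u u (v + v)
  have h₂ := hc u v v
  have h₃ := hc u v (u + v)
  rw [hs v (u + v), show v + (u + v) = u + (v + v) by abel] at h₃
  rw [← sub_eq_zero]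
  have : s (u + u) (v + v) + s u u + s v v - (2 • s u v + s (u + v) (u + v)) =
      -(s u (v + v) - s (u + u) (v + v) + s u (u + (v + v)) - s u u) +
      (s v v - s (u + v) v + s u (v + v) - s u v) +
      (s (u + v) v - s (u + v) (u + v) + s u (u + (v + v)) - s u v) := by abel
  rw [this, h₁, h₂, h₃]
  simp

lemma exists_eq_coboundaryOne_of_symm (hF : F ∈ diffTwoCochains d) (hc : IsTwoCocycle F)
    (hs : ∀ a b, F a b = F b a) : ∃ γ ∈ diffOneCochains d, F = coboundaryOne γ := by
  obtain ⟨s, G, hG, hFG⟩ := exists_eq_sum_homogeneousTwo hF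
  have hsum : ∀ u v, symbol u v F = ∑ n ∈ s, symbol u v (G n) := fun u v => by
    rw [hFG, map_sum]
  -- Replacing `(u, v)` by `(ru, rv)` and comparing powers of `r` passes symmetry, and then the
  -- cocycle identity, to each homogeneous part.
  have hsymm : ∀ n ∈ s, ∀ u v, symbol u v (G n) = symbol v u (G n) := by
    intro n hn u v
    rw [← sub_eq_zero]
    refine eq_zero_of_sum_pow_smul_eq_zero
      (a := fun n => symbol u v (G n) - symbol v u (G n)) (fun r => ?_) hn
    simp only [smul_sub, ← symbol_smul_smul (hG _), Finset.sum_sub_distrib, ← hsum]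
    rw [symbol_apply, symbol_apply, hs]
    ring
  have hcoc : ∀ n ∈ s, ∀ u v w, symbol v w (G n) - symbol (u + v) w (G n) +
      symbol u (v + w) (G n) - symbol u v (G n) = 0 := by
    intro n hn u v w
    refine eq_zero_of_sum_pow_smul_eq_zero
      (a := fun n => symbol v w (G n) - symbol (u + v) w (G n) +
        symbol u (v + w) (G n) - symbol u v (G n)) (fun r => ?_) hn
    simp only [smul_sub, smul_add, ← symbol_smul_smul (hG _), Finset.sum_sub_distrib,
      Finset.sum_add_distrib, ← hsum]
    exact hc.symbol_cocycle _ _ _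
  -- Order one is the case `2 - 2^n = 0`. There the symbol is a function of `u` plus a function of
  -- `v`, and the cocycle identity kills both.
  have hone : ∀ n ∈ s, n = 1 → ∀ u v, symbol u v (G n) = 0 := by
    intro n hn h1 u v
    have h00 : symbol (0 : Fin d → ℝ) 0 (G n) = 0 := by
      have := symbol_smul_smul (hG n) 0 u v
      rwa [zero_smul, zero_smul, h1, pow_one, zero_smul, ← h1] at this
    have h₁ := hcoc n hn u 0 0
    have h₂ := hcoc n hn 0 0 v
    simp only [add_zero, zero_add, h00] at h₁ h₂
    have h₃ : symbol u v (G n) = symbol u 0 (G n) + symbol 0 v (G n) :=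
      symbol_eq_add_of_mem_homogeneousTwo_one (h1 ▸ hG n) u v
    linear_combination h₃ - h₁ + h₂
  choose γ hγ hγ' using fun n => exists_symbol_diagonal (homogeneousTwo_le n (hG n))
  -- The coefficient is the one from the doubling identity. For `n = 1` the inverse is `0` by
  -- convention, and the corresponding symbol is zero.
  refine ⟨∑ n ∈ s, (2 - 2 ^ n : ℝ)⁻¹ • γ n,
    Submodule.sum_mem _ fun n _ => Submodule.smul_mem _ _ (hγ n), ?_⟩
  rw [← sub_eq_zero]
  refine eq_zero_of_symbol_eq_zero (diffTwoCochains_sub_mem hF (coboundaryOne_mem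
    (Submodule.sum_mem _ fun n _ => Submodule.smul_mem _ _ (hγ n)))) fun u v => ?_
  rw [map_sub, symbol_coboundaryOne, hsum]
  simp only [LinearMap.sum_apply, LinearMap.smul_apply, Finset.mul_sum, mul_smul_comm, hγ']
  rw [← Finset.sum_sub_distrib, ← Finset.sum_add_distrib, ← Finset.sum_sub_distrib]
  refine Finset.sum_eq_zero fun n hn => ?_
  by_cases h1 : n = 1
  · simp [hone n hn h1]
  have hne : (2 - 2 ^ n : ℝ) ≠ 0 := by
    intro h
    exact h1 (pow_right_injective₀ (by norm_num) (by norm_num)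
      ((sub_eq_zero.1 h).symm.trans (pow_one 2).symm))
  have hd := doubling_of_symm_cocycle (s := fun u v => symbol u v (G n)) (hsymm n hn)
    (hcoc n hn) u v
  have h2 := symbol_smul_smul (hG n) 2 u v
  rw [two_smul, two_smul] at h2
  simp only [h2] at hd
  rw [← smul_sub, ← smul_add, sub_eq_zero, eq_inv_smul_iff₀ hne, sub_smul, two_smul]
  rw [two_nsmul] at hd
  linear_combination (-1 : SmoothFun d) * hd

end Symbol

end

noncomputable section

/-! ## Rescaling infinitesimal deformations -/

section Rescaling

variable {d : ℕ}

/-- In dimension three, a smooth multiple of a Poisson structure is a Poisson structure. -/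
lemma IsPoisson.scaleCochain {P : SmoothFun 3 →ₗ[ℝ] SmoothFun 3 →ₗ[ℝ] SmoothFun 3}
    (hP : IsPoisson P) (φ : SmoothFun 3) : IsPoisson (scaleCochain φ P) := by
  obtain ⟨hs, hb, hj⟩ := hP
  refine ⟨hs.scaleCochain φ, hb.scaleCochain φ, fun a b c => ?_⟩
  have hself : ∀ a, P a a = 0 := fun a => eq_of_two_mul_eq <| by
    rw [mul_zero, two_mul]
    nth_rewrite 1 [hs a a]
    exact neg_add_cancel _
  have hform : ∀ a b, P a b =
      P (coordFun 0) (coordFun 1) *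
          (partialDeriv 0 a * partialDeriv 1 b - partialDeriv 1 a * partialDeriv 0 b) +
        P (coordFun 0) (coordFun 2) *
          (partialDeriv 0 a * partialDeriv 2 b - partialDeriv 2 a * partialDeriv 0 b) +
        P (coordFun 1) (coordFun 2) *
          (partialDeriv 1 a * partialDeriv 2 b - partialDeriv 2 a * partialDeriv 1 b) := by
    intro a b
    rw [hb.apply_eq_sum, Fintype.sum_prod_type]
    simp only [Fin.sum_univ_three, hself]
    rw [hs (coordFun 1) (coordFun 0), hs (coordFun 2) (coordFun 0), hs (coordFun 2) (coordFun 1)]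
    ring
  -- The Plücker relation, `P ∧ P = 0` evaluated on `a, b, c, φ`. This is the one point where
  -- dimension three matters.
  have hplucker : P a φ * P b c + P b φ * P c a + P c φ * P a b = 0 := by
    rw [hform a φ, hform b φ, hform c φ, hform b c, hform c a, hform a b]
    ring
  have h := hj a b c
  simp only [scaleCochain_apply, hb.2]
  linear_combination φ * φ * h + φ * hplucker

/-- The primary obstruction of a Poisson structure vanishes, in the differential subcomplex. -/
lemma IsPoisson.diffPrimaryObstructionVanishes
    {P : SmoothFun d →ₗ[ℝ] SmoothFun d →ₗ[ℝ] SmoothFun d} (hP : IsPoisson P) :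
    DiffPrimaryObstructionVanishes P := by
  obtain ⟨hs, hb, hj⟩ := hP
  refine ⟨_, secondStarTerm_mem fun i j => P (coordFun i) (coordFun j),
    compProd_eq_coboundaryTwo_secondStarTerm partialDeriv_mul partialDeriv_comm
      (fun i j => hs _ _) (fun i j k => ?_) hb.apply_eq_sum⟩
  have key : ∀ i (a : SmoothFun d), P (coordFun i) a =
      ∑ m, P (coordFun i) (coordFun m) * partialDeriv m a := fun i a => by
    rw [derivation_eq_sum (fun a b => hb.2 (coordFun i) a b) a]
    exact Finset.sum_congr rfl fun m _ => mul_comm _ _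
  -- Thus the Jacobi condition on the coefficients is the Jacobi identity on coordinate functions.
  have hQ : ∀ i j k, contractDeriv partialDeriv (fun i j => P (coordFun i) (coordFun j)) i j k =
      -P (coordFun i) (P (coordFun j) (coordFun k)) := by
    intro i j k
    rw [key i, contractDeriv, ← Finset.sum_neg_distrib]
    refine Finset.sum_congr rfl fun m _ => ?_
    rw [hs (coordFun m) (coordFun i), neg_mul]
  rw [hQ, hQ, hQ]
  linear_combination (-1 : SmoothFun d) * hj (coordFun i) (coordFun j) (coordFun k)

lemma DiffPrimaryObstructionVanishes.primaryObstructionVanishes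
    {F : SmoothFun d →ₗ[ℝ] SmoothFun d →ₗ[ℝ] SmoothFun d}
    (h : DiffPrimaryObstructionVanishes F) : PrimaryObstructionVanishes F := by
  obtain ⟨G, -, hG⟩ := h
  exact ⟨G, hG⟩

lemma skewPart_mem {F : SmoothFun d →ₗ[ℝ] SmoothFun d →ₗ[ℝ] SmoothFun d}
    (hF : F ∈ diffTwoCochains d) : skewPart F ∈ diffTwoCochains d := by
  have e : skewPart F = (1 / 2 : ℝ) • (F - F.flip) := by
    ext1 a
    ext1 b
    rfl
  rw [e]
  exact Submodule.smul_mem _ _ (diffTwoCochains_sub_mem hF (flip_mem hF))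

/-- The Hochschild–Kostant–Rosenberg theorem in degree two: a differential 2-cocycle is
cohomologous to its skew part, through a differential 1-cochain. -/
lemma IsTwoCocycle.exists_eq_skewPart_add {F : SmoothFun d →ₗ[ℝ] SmoothFun d →ₗ[ℝ] SmoothFun d}
    (hF : IsTwoCocycle F) (hd : F ∈ diffTwoCochains d) :
    ∃ γ ∈ diffOneCochains d, ∀ a b, F a b = skewPart F a b + coboundaryOne γ a b := by
  -- The skew part is itself a cocycle, so the remainder is a symmetric differential cocycle.
  obtain ⟨γ, hγ, h⟩ := exists_eq_coboundaryOne_of_symm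
    (diffTwoCochains_sub_mem hd (skewPart_mem hd))
    (hF.sub hF.isBiderivation_skewPart.isTwoCocycle) fun a b => eq_of_two_mul_eq <| by
      have h₁ := two_mul_skewPart_apply F a b
      have h₂ := two_mul_skewPart_apply F b a
      simp only [LinearMap.sub_apply]
      linear_combination h₂ - h₁
  refine ⟨γ, hγ, fun a b => ?_⟩
  rw [← h]
  simp

end Rescaling

end

noncomputable section

/-! ### Transfer from the skew part back to the cocycle -/

section Rescaling

variable {d : ℕ}

lemma DiffPrimaryObstructionVanishes.of_eq_add_coboundaryOne
    {F P : SmoothFun d →ₗ[ℝ] SmoothFun d →ₗ[ℝ] SmoothFun d} {γ : SmoothFun d →ₗ[ℝ] SmoothFun d}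
    (hv : DiffPrimaryObstructionVanishes P) (hd : P ∈ diffTwoCochains d)
    (hγ : γ ∈ diffOneCochains d) (hP : IsTwoCocycle P)
    (h : ∀ a b, F a b = P a b + coboundaryOne γ a b) : DiffPrimaryObstructionVanishes F := by
  obtain ⟨G, hGd, hG⟩ := hv
  refine ⟨G + gaugeCorrection P γ, Submodule.add_mem _ hGd (gaugeCorrection_mem hd hγ),
    fun a b c => ?_⟩
  rw [compProd_of_eq_add_coboundaryOne hP h, hG]
  exact (coboundaryTwo_add _ _ a b c).symm

/-- A smooth multiple of a differential 2-cocycle in dimension three whose primary obstruction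
vanishes has a primary obstruction that vanishes in the differential subcomplex. -/
lemma PrimaryObstructionVanishes.scaleCochain_of_mem
    {F : SmoothFun 3 →ₗ[ℝ] SmoothFun 3 →ₗ[ℝ] SmoothFun 3} (hv : PrimaryObstructionVanishes F)
    (hd : F ∈ diffTwoCochains 3) (hF : IsTwoCocycle F) (φ : SmoothFun 3) :
    DiffPrimaryObstructionVanishes (scaleCochain φ F) := by
  obtain ⟨γ, hγ, h⟩ := hF.exists_eq_skewPart_add hd
  have hb := hF.isBiderivation_skewPart
  -- The cochain bounding `F ∘ F` may be arbitrary here: it serves only to obtain Jacobi, after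
  -- which `secondStarTerm` provides a differential one.
  have hskew : PrimaryObstructionVanishes (skewPart F) :=
    hv.of_eq_add_coboundaryOne (γ := -γ) hF fun a b => by
      rw [coboundaryOne_neg_apply, h, add_neg_cancel_right]
  have hP := (hb.isPoisson (isSkew_skewPart F) hskew).scaleCochain φ
  exact hP.diffPrimaryObstructionVanishes.of_eq_add_coboundaryOne
    (scaleCochain_mem φ (skewPart_mem hd)) (mulLeft_comp_mem φ hγ) hP.2.1.isTwoCocycle
    (scaleCochain_eq_add_coboundaryOne h φ)

end Rescaling

end

theorem theorem6 (φ : SmoothFun 3) :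
    (∀ F : SmoothFun 3 →ₗ[ℝ] SmoothFun 3 →ₗ[ℝ] SmoothFun 3,
      IsInfinitesimalDeformation F → PrimaryObstructionVanishes F →
        IsInfinitesimalDeformation (scaleCochain φ F) ∧
          PrimaryObstructionVanishes (scaleCochain φ F)) ∧
    (∀ F : SmoothFun 3 →ₗ[ℝ] SmoothFun 3 →ₗ[ℝ] SmoothFun 3,
      F ∈ diffTwoCochains 3 → IsTwoCocycle F → DiffPrimaryObstructionVanishes F →
        scaleCochain φ F ∈ diffTwoCochains 3 ∧ IsTwoCocycle (scaleCochain φ F) ∧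
          DiffPrimaryObstructionVanishes (scaleCochain φ F)) ∧
    (∀ F : SmoothFun 3 →ₗ[ℝ] SmoothFun 3 →ₗ[ℝ] SmoothFun 3,
      IsPoisson F → IsPoisson (scaleCochain φ F)) := by
  refine ⟨?_, fun F hd hF hv => ⟨scaleCochain_mem φ hd, hF.scaleCochain φ,
    hv.primaryObstructionVanishes.scaleCochain_of_mem hd hF φ⟩, fun F hF => hF.scaleCochain φ⟩
  rintro F ⟨hF, γ, hγ⟩ hv
  -- `D` is the differential representative of the class of `F`. The map `γ` need not be
  -- differential, so the return from `φD` to `φF` yields only a bilinear bounding cochain.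
  obtain ⟨D, hD⟩ : ∃ D, D = F - coboundaryOne γ := ⟨_, rfl⟩
  rw [← hD] at hγ
  have h : ∀ a b, F a b = D a b + coboundaryOne γ a b := fun a b => by
    rw [hD, LinearMap.sub_apply, LinearMap.sub_apply, sub_add_cancel]
  have hDc : IsTwoCocycle D := by
    rw [hD]
    exact hF.sub (isTwoCocycle_coboundaryOne γ)
  have hDv : PrimaryObstructionVanishes D :=
    hv.of_eq_add_coboundaryOne (γ := -γ) hF fun a b => by
      rw [coboundaryOne_neg_apply, h, add_neg_cancel_right]
  have hφ := scaleCochain_eq_add_coboundaryOne h φ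
  refine ⟨⟨hF.scaleCochain φ, LinearMap.mulLeft ℝ φ ∘ₗ γ, ?_⟩, ?_⟩
  · have e : scaleCochain φ F - coboundaryOne (LinearMap.mulLeft ℝ φ ∘ₗ γ) =
        scaleCochain φ D := by
      ext1 a
      ext1 b
      rw [LinearMap.sub_apply, LinearMap.sub_apply, hφ, add_sub_cancel_right]
    rw [e]
    exact scaleCochain_mem φ hγ
  · exact (hDv.scaleCochain_of_mem hγ hDc φ).primaryObstructionVanishes.of_eq_add_coboundaryOne
      (hDc.scaleCochain φ) hφ
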